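/- Proposition 3.7. Let $n\ge 2$ be an integer. For an upper triangular real $n\times n$ matrix $M$ with rows and columns labelled $1,\dots,n$ and a set $I\subset\{1,\dots,n\}$, let $\Delta_I(M)$ be the minor of $M$ with rows $I$ and the last $|I|$ columns, and let $\Delta^I(M)$ be the minor with the first $|I|$ rows and columns $I$, where $\Delta_\emptyset=\Delta^\emptyset=1$. Let $N_n^+$ be the set of real upper triangular matrices $M$ with all diagonal entries $1$ such that every minor of $M$ that does not vanish identically on the group of invertible upper triangular real $n\times n$ matrices is positive. Write $[a,b]=\{i\in\mathbb N: a\le i\le b\}$ and $T_n=\{(a,b,c)\in\mathbb N^3: 1\le a<b<c\le n\}$. For $(a,b,c)\in T_n$ put (all minors being those of $M$) $$Y_{abc}(M)=\frac{\Delta_{[a,b-1]\cup[c+1,n]}\,\Delta_{[a+1,b]\cup[c,n]}}{\Delta_{[a,b]\cup[c+1,n]}\,\Delta_{[a+1,b-1]\cup[c,n]}},\qquad \tilde Y_{abc}(M)=\frac{\Delta_{[1,a]\cup[b+1,c-1]}\,\Delta_{[1,a-1]\cup[b,c]}}{\Delta_{[1,a]\cup[b,c-1]}\,\Delta_{[1,a-1]\cup[b+1,c]}},$$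 $$Y^{abc}(M)=\frac{\Delta^{[a,b]\cup[c+1,n]}\,\Delta^{[a+1,b-1]\cup[c,n]}}{\Delta^{[a,b-1]\cup[c+1,n]}\,\Delta^{[a+1,b]\cup[c,n]}},\qquad \tilde Y^{abc}(M)=\frac{\Delta^{[1,a]\cup[b,c-1]}\,\Delta^{[1,a-1]\cup[b+1,c]}}{\Delta^{[1,a]\cup[b+1,c-1]}\,\Delta^{[1,a-1]\cup[b,c]}}.$$ For $x>0$ let $l(x)=\frac{6}{\pi^2}L\bigl(\frac{x}{1+x}\bigr)$, where $L(x)=\sum_{k\ge1}\frac{x^k}{k^2}+\frac12\log x\,\log(1-x)$ for $0<x<1$ is the Rogers dilogarithm. Then for every $M\in N_n^+$ all the numbers $Y_{abc}(M)$, $\tilde Y^{abc}(M)$, $\tilde Y_{abc}(M)$, $Y^{abc}(M)$ with $(a,b,c)\in T_n$ are positive (so that $l$ is defined at them), and $$\sum_{(a,b,c)\in T_n} l\bigl(Y_{abc}(M)\bigr)=\sum_{(a,b,c)\in T_n} l\bigl(\tilde Y^{abc}(M)\bigr)=\sum_{(a,b,c)\in T_n} l\bigl(\tilde Y_{abc}(M)\bigr)=\sum_{(a,b,c)\in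 T_n} l\bigl(Y^{abc}(M)\bigr).$$ -/

import Mathlib

namespace TPDilog

open scoped BigOperators

noncomputable section

/-- The group `B_n` of real invertible upper triangular `n × n` matrices. -/
def IsInvUpper {n : ℕ} (G : Matrix (Fin n) (Fin n) ℝ) : Prop :=
  (∀ i j : Fin n, j < i → G i j = 0) ∧ IsUnit G.det

/-- The group `N_n` of upper unitriangular matrices inside `B_n`. -/
def IsUnipotentUpper {n : ℕ} (G : Matrix (Fin n) (Fin n) ℝ) : Prop :=
  IsInvUpper G ∧ ∀ i : Fin n, G i i = 1

/-- The minor of `G` with rows `r 0 < r 1 < ...` and columns `c 0 < c 1 < ...`. -/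
def minor {n k : ℕ} (G : Matrix (Fin n) (Fin n) ℝ) (r c : Fin k ↪o Fin n) : ℝ :=
  (G.submatrix r c).det

/-- The minor with rows `r` and columns `c` vanishes identically on `B_n`. -/
def VanishesIdentically {n k : ℕ} (r c : Fin k ↪o Fin n) : Prop :=
  ∀ H : Matrix (Fin n) (Fin n) ℝ, IsInvUpper H → minor H r c = 0

/-- `G ∈ B_n` is totally positive (with respect to `B_n`): every minor that does not vanish
identically on `B_n` is positive at `G`. -/
def IsTotallyPositive {n : ℕ} (G : Matrix (Fin n) (Fin n) ℝ) : Prop :=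
  IsInvUpper G ∧
    ∀ (k : ℕ) (r c : Fin k ↪o Fin n), ¬ VanishesIdentically r c → 0 < minor G r c

/-- `N_n^+`, the set of totally positive matrices in `N_n`. -/
def NPlus (n : ℕ) : Set (Matrix (Fin n) (Fin n) ℝ) :=
  {M | IsUnipotentUpper M ∧ IsTotallyPositive M}

/-- The increasing enumeration of the first `k` elements of `Fin n`. -/
def firstEmb {k n : ℕ} (h : k ≤ n) : Fin k ↪o Fin n :=
  OrderEmbedding.ofStrictMono (fun j => ⟨j.val, by omega⟩) (fun _ _ hij => hij)

/-- The increasing enumeration of the last `k` elements of `Fin n`. -/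
def lastEmb {k n : ℕ} (h : k ≤ n) : Fin k ↪o Fin n :=
  OrderEmbedding.ofStrictMono (fun j => ⟨n - k + j.val, by omega⟩)
    (fun _ _ hij => Nat.add_lt_add_left hij (n - k))

theorem card_le {n : ℕ} (I : Finset (Fin n)) : I.card ≤ n := by
  simpa using I.card_le_univ

/-- The right flag minor `Δ_I(G)`: rows `I`, last `|I|` columns (equal to `1` if `I = ∅`). -/
def rightMinor {n : ℕ} (G : Matrix (Fin n) (Fin n) ℝ) (I : Finset (Fin n)) : ℝ :=
  minor G (I.orderEmbOfFin rfl) (lastEmb (card_le I))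

/-- The upper flag minor `Δ^J(G)`: first `|J|` rows, columns `J` (equal to `1` if `J = ∅`). -/
def upperMinor {n : ℕ} (G : Matrix (Fin n) (Fin n) ℝ) (J : Finset (Fin n)) : ℝ :=
  minor G (firstEmb (card_le J)) (J.orderEmbOfFin rfl)

/-- The interval `[a,b] = {i | a ≤ i ≤ b}` of `{1,…,n}`. Rows and columns are labelled `1,…,n`:
the element `i : Fin n` carries the label `i + 1`. -/
def seg (n a b : ℕ) : Finset (Fin n) :=
  Finset.univ.filter (fun i => a ≤ i.val + 1 ∧ i.val + 1 ≤ b)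

/-- `Y_{abc}(M)`. -/
def YLow {n : ℕ} (M : Matrix (Fin n) (Fin n) ℝ) (a b c : ℕ) : ℝ :=
  (rightMinor M (seg n a (b - 1) ∪ seg n (c + 1) n) *
      rightMinor M (seg n (a + 1) b ∪ seg n c n)) /
    (rightMinor M (seg n a b ∪ seg n (c + 1) n) *
      rightMinor M (seg n (a + 1) (b - 1) ∪ seg n c n))

/-- `Ỹ_{abc}(M)`. -/
def YTildeLow {n : ℕ} (M : Matrix (Fin n) (Fin n) ℝ) (a b c : ℕ) : ℝ :=
  (rightMinor M (seg n 1 a ∪ seg n (b + 1) (c - 1)) *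
      rightMinor M (seg n 1 (a - 1) ∪ seg n b c)) /
    (rightMinor M (seg n 1 a ∪ seg n b (c - 1)) *
      rightMinor M (seg n 1 (a - 1) ∪ seg n (b + 1) c))

/-- `Y^{abc}(M)`. -/
def YUp {n : ℕ} (M : Matrix (Fin n) (Fin n) ℝ) (a b c : ℕ) : ℝ :=
  (upperMinor M (seg n a b ∪ seg n (c + 1) n) *
      upperMinor M (seg n (a + 1) (b - 1) ∪ seg n c n)) /
    (upperMinor M (seg n a (b - 1) ∪ seg n (c + 1) n) *
      upperMinor M (seg n (a + 1) b ∪ seg n c n))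

/-- `Ỹ^{abc}(M)`. -/
def YTildeUp {n : ℕ} (M : Matrix (Fin n) (Fin n) ℝ) (a b c : ℕ) : ℝ :=
  (upperMinor M (seg n 1 a ∪ seg n b (c - 1)) *
      upperMinor M (seg n 1 (a - 1) ∪ seg n (b + 1) c)) /
    (upperMinor M (seg n 1 a ∪ seg n (b + 1) (c - 1)) *
      upperMinor M (seg n 1 (a - 1) ∪ seg n b c))

/-- The discrete tetrahedron `T_n = {(a,b,c) | 1 ≤ a < b < c ≤ n}`. -/
def tetra (n : ℕ) : Finset (ℕ × ℕ × ℕ) :=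
  (Finset.Icc 1 n ×ˢ Finset.Icc 1 n ×ˢ Finset.Icc 1 n).filter
    (fun t => t.1 < t.2.1 ∧ t.2.1 < t.2.2)

/-- The dilogarithm `Li₂(x) = ∑_{k ≥ 1} x^k / k²` (the series converges for `|x| ≤ 1`). -/
def Li2 (x : ℝ) : ℝ := ∑' k : ℕ, x ^ (k + 1) / ((k : ℝ) + 1) ^ 2

/-- The Rogers dilogarithm, used for `0 < x < 1`. -/
def rogersL (x : ℝ) : ℝ := Li2 x + 1 / 2 * Real.log x * Real.log (1 - x)

/-- The function `l(x) = (6/π²) L(x/(1+x))`, used for `x > 0`. -/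
def ell (x : ℝ) : ℝ := 6 / Real.pi ^ 2 * rogersL (x / (1 + x))

end

end TPDilog

namespace TPDilog
open Filter Topology

/-! The argument combines five-term dilogarithm relations with three-term Plücker relations, and
then compares the two kinds of flag minors.

Let `D` be a positive function of subsets of `[1,n]` satisfying the three-term Plücker relations.
Every triple `a < b < c` and base set `S` give a cross-ratio `crossY D S a b c`. For four indices
outside `J`, take each of the four triples with base `J` and with base `J` plus the fourth index.
The `ell`-values of these eight cross-ratios satisfy one linear relation (`crossY_octagon`), because
in suitable coordinates the eight arguments are those of two five-term relations sharing a term.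

Both `Y_{abc}` and `Ỹ_{abc}` are cross-ratios of the triple `abc`, with base sets that are
complementary off the triple. Changing the first base set into the second one index `w` at a time
makes the difference of the two sums a telescoping sum over pairs (triple, `w`). Grouped by the
underlying quadruple, the four changes cancel by the octagon relation (`sum_ell_crossY`). Right flag
minors give the equality for the lower families. Upper flag minors give it for the upper families,
whose members are inverse cross-ratios, handled by `ell x + ell x⁻¹ = 2 * ell 1`.

Lower and upper families are linked term by term. For unitriangular `M`, the minors in `Y_{abc}` and
in `Ỹ^{a,a+c-b,c}` reduce to the same solid minors (`YLow_eq_YTildeUp`), and `b ↦ a+c-b` is an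
involution of the index set. Positivity holds because no flag minor vanishes identically on the
upper triangular group. -/

/-! ### Functional equations of the Rogers dilogarithm. -/

theorem hasDerivAt_Li2_tsum {x : ℝ} (hx : |x| < 1) :
    HasDerivAt Li2 (∑' k : ℕ, x ^ k / ((k : ℝ) + 1)) x := by
  obtain ⟨r, hxr, hr⟩ := exists_between hx
  have hr0 : 0 < r := (abs_nonneg x).trans_lt hxr
  have hmem : ∀ {y : ℝ}, y ∈ Metric.ball (0 : ℝ) r ↔ |y| < r := by
    intro y; simp
  refine hasDerivAt_tsum_of_isPreconnected (u := fun k => r ^ k)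
    (g := fun (k : ℕ) (y : ℝ) => y ^ (k + 1) / ((k : ℝ) + 1) ^ 2)
    (g' := fun k y => y ^ k / ((k : ℝ) + 1)) (y₀ := 0)
    (summable_geometric_of_lt_one hr0.le hr) Metric.isOpen_ball
    (convex_ball (0 : ℝ) r).isPreconnected ?_ ?_ (by simpa using hr0) ?_ (hmem.2 hxr)
  · intro k y _
    have h : ((k : ℝ) + 1) ≠ 0 := by positivity
    refine HasDerivAt.congr_deriv ((hasDerivAt_pow (k + 1) y).div_const (((k : ℝ) + 1) ^ 2)) ?_
    push_cast
    field_simp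
  · intro k y hy
    have hy' := (hmem.1 hy).le
    rw [Real.norm_eq_abs, abs_div, abs_pow, abs_of_pos (by positivity : (0 : ℝ) < (k : ℝ) + 1)]
    calc |y| ^ k / ((k : ℝ) + 1) ≤ |y| ^ k := div_le_self (by positivity) (by simp)
      _ ≤ r ^ k := by gcongr
  · simp

theorem hasDerivAt_Li2 {x : ℝ} (h0 : 0 < x) (h1 : x < 1) :
    HasDerivAt Li2 (-Real.log (1 - x) / x) x := by
  have hx : |x| < 1 := by rwa [abs_of_pos h0]
  refine HasDerivAt.congr_deriv (hasDerivAt_Li2_tsum hx) ?_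
  have h := (Real.hasSum_pow_div_log_of_abs_lt_one hx).div_const x
  rw [← h.tsum_eq]
  refine tsum_congr fun k => ?_
  rw [pow_succ]
  field_simp

theorem hasDerivAt_rogersL {x : ℝ} (h0 : 0 < x) (h1 : x < 1) :
    HasDerivAt rogersL (-(Real.log (1 - x) / x + Real.log x / (1 - x)) / 2) x := by
  have h1' : (1 : ℝ) - x ≠ 0 := by linarith
  have hl := Real.hasDerivAt_log h0.ne'
  have hl' : HasDerivAt (fun y : ℝ => Real.log (1 - y)) (-1 / (1 - x)) x :=
    ((hasDerivAt_id x).const_sub 1).log h1'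
  refine HasDerivAt.congr_deriv ((hasDerivAt_Li2 h0 h1).add ((hl.const_mul (1 / 2)).mul hl')) ?_
  field_simp
  ring

theorem hasDerivAt_ell {x : ℝ} (hx : 0 < x) :
    HasDerivAt ell (6 / Real.pi ^ 2 *
      ((Real.log (1 + x) / x - Real.log x / (1 + x)) / 2)) x := by
  have h1 : 0 < 1 + x := by linarith
  have hm : HasDerivAt (fun y : ℝ => y / (1 + y)) (1 / (1 + x) ^ 2) x := by
    refine HasDerivAt.congr_deriv ((hasDerivAt_id x).div ((hasDerivAt_id x).const_add 1) h1.ne') ?_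
    simp
  have hlt : x / (1 + x) < 1 := by rw [div_lt_one h1]; linarith
  have he : 1 - x / (1 + x) = (1 + x)⁻¹ := by field_simp; ring
  refine HasDerivAt.congr_deriv (((hasDerivAt_rogersL (by positivity) hlt).comp x hm).const_mul (6 / Real.pi ^ 2)) ?_
  rw [he, Real.log_inv, Real.log_div hx.ne' h1.ne']
  field_simp
  ring

theorem hasDerivAt_ell_comp {f : ℝ → ℝ} {f' x : ℝ} (hf : HasDerivAt f f' x) (hx : 0 < f x) :
    HasDerivAt (fun y => ell (f y)) (6 / Real.pi ^ 2 *
      ((Real.log (1 + f x) / f x - Real.log (f x) / (1 + f x)) / 2) * f') x :=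
  (hasDerivAt_ell hx).comp x hf

theorem tendsto_ell_zero : Tendsto ell (𝓝[>] 0) (𝓝 0) := by
  have hLi : Tendsto (fun x : ℝ => Li2 (x / (1 + x))) (𝓝[>] 0) (𝓝 0) := by
    have h0 : Li2 0 = 0 := by simp [Li2]
    have hc : ContinuousAt Li2 ((0 : ℝ) / (1 + 0)) := by
      rw [zero_div]
      exact (hasDerivAt_Li2_tsum (by simp)).continuousAt
    have hm : ContinuousAt (fun x : ℝ => x / (1 + x)) 0 := by
      apply ContinuousAt.div <;> first | fun_prop | simp
    have := (ContinuousAt.comp (f := fun x : ℝ => x / (1 + x)) hc hm).tendsto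
    simp only [Function.comp_def, zero_div, h0] at this
    exact this.mono_left nhdsWithin_le_nhds
  have hlog : Tendsto (fun x : ℝ => Real.log x * Real.log (1 + x)) (𝓝[>] 0) (𝓝 0) := by
    have h : Tendsto (fun x : ℝ => |Real.log x * x|) (𝓝[>] 0) (𝓝 0) := by
      simpa using (tendsto_log_mul_rpow_nhdsGT_zero one_pos).abs
    -- Since `0 ≤ log (1 + x) ≤ x`, the product is dominated by `|x log x|`, which tends to zero.
    refine squeeze_zero_norm' ?_ h
    filter_upwards [self_mem_nhdsWithin] with x (hx : 0 < x)
    have h1 : 0 ≤ Real.log (1 + x) := Real.log_nonneg (by linarith)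
    have h2 : Real.log (1 + x) ≤ x := by
      have := Real.log_le_sub_one_of_pos (show 0 < 1 + x by linarith)
      linarith
    rw [Real.norm_eq_abs, abs_mul, abs_mul, abs_of_nonneg h1, abs_of_pos hx]
    gcongr
  have hlog1 : Tendsto (fun x : ℝ => Real.log (1 + x)) (𝓝[>] 0) (𝓝 0) := by
    have : ContinuousAt (fun x : ℝ => Real.log (1 + x)) 0 := by
      apply ContinuousAt.log <;> first | fun_prop | simp
    have := this.tendsto
    simp only [add_zero, Real.log_one] at this
    exact this.mono_left nhdsWithin_le_nhds
  have h := (hLi.add (((hlog.sub (hlog1.mul hlog1)).const_mul (-1 / 2)))).const_mul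
    (6 / Real.pi ^ 2)
  simp only [mul_zero, sub_zero, add_zero] at h
  refine h.congr' ?_
  filter_upwards [self_mem_nhdsWithin] with x (hx : 0 < x)
  have h1 : 0 < 1 + x := by linarith
  have he : 1 - x / (1 + x) = (1 + x)⁻¹ := by field_simp; ring
  rw [ell, rogersL, he, Real.log_inv, Real.log_div hx.ne' h1.ne']
  ring

theorem eq_of_hasDerivAt_zero_pos {g : ℝ → ℝ} (hg : ∀ x, 0 < x → HasDerivAt g 0 x) {x y : ℝ}
    (hx : 0 < x) (hy : 0 < y) : g x = g y :=
  isOpen_Ioi.is_const_of_deriv_eq_zero (convex_Ioi (0 : ℝ)).isPreconnected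
    (fun z hz => (hg z hz).differentiableAt.differentiableWithinAt)
    (fun z hz => (hg z hz).deriv) hx hy

/-- The five-term relation. -/
theorem ell_pentagon {x y : ℝ} (hx : 0 < x) (hy : 0 < y) :
    ell x + ell y = ell (x * y / (1 + x + y)) + ell (x / (1 + y)) + ell (y / (1 + x)) := by
  set g : ℝ → ℝ := fun x => ell x + ell y - (ell (x * y / (1 + x + y)) + ell (x / (1 + y)) +
    ell (y / (1 + x))) with hgdef
  -- For fixed `y` the difference of the two sides has zero derivative in the first variable. Its
  -- constant value is then read off as the limit at `0⁺`, where only `ell y - ell y` survives.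
  have hg : ∀ z, 0 < z → HasDerivAt g 0 z := by
    intro z hz
    have e1 : 0 < 1 + z := by linarith
    have e2 : 0 < 1 + y := by linarith
    have e3 : 0 < 1 + z + y := by linarith
    have d1 : HasDerivAt (fun x : ℝ => x * y / (1 + x + y)) (y * (1 + y) / (1 + z + y) ^ 2) z := by
      refine HasDerivAt.congr_deriv (((hasDerivAt_id z).mul_const y).div
        (((hasDerivAt_id z).const_add 1).add_const y) e3.ne') ?_
      simp only [id]
      ring
    have d2 : HasDerivAt (fun x : ℝ => x / (1 + y)) (1 / (1 + y)) z :=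
      (hasDerivAt_id z).div_const _
    have d3 : HasDerivAt (fun x : ℝ => y / (1 + x)) (-y / (1 + z) ^ 2) z := by
      refine HasDerivAt.congr_deriv ((hasDerivAt_const z y).div ((hasDerivAt_id z).const_add 1) e1.ne') ?_
      simp
    have q1 := hasDerivAt_ell_comp d1 (by positivity)
    have q2 := hasDerivAt_ell_comp d2 (by positivity)
    have q3 := hasDerivAt_ell_comp d3 (by positivity)
    refine HasDerivAt.congr_deriv (((hasDerivAt_ell hz).add_const (ell y)).sub ((q1.add q2).add q3)) ?_
    have f1 : 1 + z * y / (1 + z + y) = (1 + z) * (1 + y) / (1 + z + y) := by field_simp; ring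
    have f2 : 1 + z / (1 + y) = (1 + z + y) / (1 + y) := by field_simp; ring
    have f3 : 1 + y / (1 + z) = (1 + z + y) / (1 + z) := by field_simp
    rw [f1, f2, f3]
    rw [Real.log_div (by positivity) e3.ne', Real.log_div (by positivity) e3.ne',
      Real.log_div (by positivity) e2.ne', Real.log_div (by positivity) e2.ne',
      Real.log_div (by positivity) e1.ne', Real.log_div (by positivity) e1.ne',
      Real.log_mul (by positivity) (by positivity), Real.log_mul (by positivity) (by positivity)]
    field_simp
    ring
  have hlim : Tendsto g (𝓝[>] 0) (𝓝 0) := by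
    have t1 : Tendsto (fun x : ℝ => ell (x * y / (1 + x + y))) (𝓝[>] 0) (𝓝 0) := by
      refine tendsto_ell_zero.comp (tendsto_nhdsWithin_iff.2 ⟨?_, ?_⟩)
      · have : ContinuousAt (fun x : ℝ => x * y / (1 + x + y)) 0 := by
          apply ContinuousAt.div <;> first | fun_prop | (simp; linarith)
        have := this.tendsto
        simp only [zero_mul, zero_div] at this
        exact this.mono_left nhdsWithin_le_nhds
      · filter_upwards [self_mem_nhdsWithin] with x (hx : 0 < x)
        exact Set.mem_Ioi.2 (by positivity)
    have t2 : Tendsto (fun x : ℝ => ell (x / (1 + y))) (𝓝[>] 0) (𝓝 0) := by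
      refine tendsto_ell_zero.comp (tendsto_nhdsWithin_iff.2 ⟨?_, ?_⟩)
      · have : ContinuousAt (fun x : ℝ => x / (1 + y)) 0 := by fun_prop
        have := this.tendsto
        simp only [zero_div] at this
        exact this.mono_left nhdsWithin_le_nhds
      · filter_upwards [self_mem_nhdsWithin] with x (hx : 0 < x)
        exact Set.mem_Ioi.2 (by positivity)
    have t3 : Tendsto (fun x : ℝ => ell (y / (1 + x))) (𝓝[>] 0) (𝓝 (ell y)) := by
      have hm : Tendsto (fun x : ℝ => y / (1 + x)) (𝓝[>] 0) (𝓝 y) := by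
        have : ContinuousAt (fun x : ℝ => y / (1 + x)) 0 := by
          apply ContinuousAt.div <;> first | fun_prop | simp
        have := this.tendsto
        simp only [add_zero, div_one] at this
        exact this.mono_left nhdsWithin_le_nhds
      exact (hasDerivAt_ell hy).continuousAt.tendsto.comp hm
    have := (tendsto_ell_zero.add (tendsto_const_nhds (x := ell y))).sub ((t1.add t2).add t3)
    simpa using this
  have hconst : Tendsto g (𝓝[>] 0) (𝓝 (g x)) := by
    refine tendsto_const_nhds.congr' ?_
    filter_upwards [self_mem_nhdsWithin] with z (hz : 0 < z)
    exact eq_of_hasDerivAt_zero_pos hg hx hz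
  have := tendsto_nhds_unique hconst hlim
  simp only [hgdef] at this
  linarith

theorem ell_add_ell_inv {x : ℝ} (hx : 0 < x) : ell x + ell x⁻¹ = 2 * ell 1 := by
  have hg : ∀ z : ℝ, 0 < z → HasDerivAt (fun x => ell x + ell x⁻¹) 0 z := by
    intro z hz
    have e1 : 0 < 1 + z := by linarith
    have q := hasDerivAt_ell_comp (hasDerivAt_inv hz.ne') (by positivity)
    refine HasDerivAt.congr_deriv ((hasDerivAt_ell hz).add q) ?_
    have f1 : 1 + z⁻¹ = (1 + z) / z := by field_simp; ring
    rw [f1, Real.log_inv, Real.log_div e1.ne' hz.ne']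
    field_simp
    ring
  have := eq_of_hasDerivAt_zero_pos hg hx one_pos
  simp only [inv_one] at this
  linarith

/-- An eight-term relation, composed of two five-term relations. -/
theorem ell_octagon {p q r s : ℝ} (hp : 0 < p) (hq : 0 < q) (hr : 0 < r) (hs : 0 < s) :
    ell (s * (p + q + r) * q / ((q + r + s * p) * r)) + ell ((q + r) / p) +
        ell (p * s / (q + r)) + ell (r / q) =
      ell (q / p) + ell ((p + q) * s / r) + ell (r / (p + q)) +
        ell (p * (r + s * (p + q)) / (q * (p + q + r))) := by
  -- The arguments are chosen so that both five-term relations contain `ell (p * r / (q * (p + q +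
  -- r)))`, which cancels on subtraction.
  have h1 := ell_pentagon (x := (q + r) / p) (y := r / q) (by positivity) (by positivity)
  have h2 := ell_pentagon (x := (p + q) * s / r) (y := p * (r + s * (p + q)) / (q * (p + q + r)))
    (by positivity) (by positivity)
  have a1 : (q + r) / p * (r / q) / (1 + (q + r) / p + r / q) = r / (p + q) := by
    have : 1 + (q + r) / p + r / q = (p + q) * (q + r) / (p * q) := by field_simp; ring
    rw [this]; field_simp
  have a2 : (q + r) / p / (1 + r / q) = q / p := by
    have : 1 + r / q = (q + r) / q := by field_simp
    rw [this]; field_simp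
  have a3 : r / q / (1 + (q + r) / p) = p * r / (q * (p + q + r)) := by
    have : 1 + (q + r) / p = (p + q + r) / p := by field_simp; ring
    rw [this]; field_simp
  have c1 : 1 + (p + q) * s / r = (r + s * (p + q)) / r := by field_simp
  have c2 : 1 + p * (r + s * (p + q)) / (q * (p + q + r)) =
      (p + q) * (q + r + s * p) / (q * (p + q + r)) := by field_simp; ring
  have c3 : 1 + (p + q) * s / r + p * (r + s * (p + q)) / (q * (p + q + r)) =
      (p + q) * (q + r) * (r + s * (p + q)) / (r * (q * (p + q + r))) := by field_simp; ring
  have b1 : (p + q) * s / r * (p * (r + s * (p + q)) / (q * (p + q + r))) /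
      (1 + (p + q) * s / r + p * (r + s * (p + q)) / (q * (p + q + r))) = p * s / (q + r) := by
    rw [c3]; field_simp
  have b2 : (p + q) * s / r / (1 + p * (r + s * (p + q)) / (q * (p + q + r))) =
      s * (p + q + r) * q / ((q + r + s * p) * r) := by
    rw [c2]; field_simp
  have b3 : p * (r + s * (p + q)) / (q * (p + q + r)) / (1 + (p + q) * s / r) =
      p * r / (q * (p + q + r)) := by
    rw [c1]; field_simp
  rw [a1, a2, a3] at h1
  rw [b1, b2, b3] at h2
  linarith


/-! ### Cross-ratios of Plücker-type functions and the telescoping argument. -/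

/-- A positive function on subsets of `ℕ` subject to the three-term relations
`D(Sac) D(Sb) = D(Sab) D(Sc) + D(Sbc) D(Sa)` for indices `a < b < c` in `[1, n]`. -/
structure IsFlagLike (n : ℕ) (D : Set ℕ → ℝ) : Prop where
  pos : ∀ S, 0 < D S
  congr : ∀ S T : Set ℕ, (∀ i, 1 ≤ i → i ≤ n → (i ∈ S ↔ i ∈ T)) → D S = D T
  rel : ∀ (S : Set ℕ) (a b c : ℕ), 1 ≤ a → a < b → b < c → c ≤ n → a ∉ S → b ∉ S → c ∉ S →
    D (insert a (insert c S)) * D (insert b S) =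
      D (insert a (insert b S)) * D (insert c S) + D (insert b (insert c S)) * D (insert a S)

/-- The cross-ratio attached to `a < b < c` and a base set `S`. -/
noncomputable def crossY (D : Set ℕ → ℝ) (S : Set ℕ) (a b c : ℕ) : ℝ :=
  (D (insert a S) * D (insert b (insert c S))) / (D (insert a (insert b S)) * D (insert c S))

theorem crossY_pos {n : ℕ} {D : Set ℕ → ℝ} (hD : IsFlagLike n D) (S : Set ℕ) (a b c : ℕ) :
    0 < crossY D S a b c :=
  div_pos (mul_pos (hD.pos _) (hD.pos _)) (mul_pos (hD.pos _) (hD.pos _))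

/-- Divided by the product of the three single-index values, a three-term relation says that
`ac/(A*C) = ab/(A*B) + bc/(B*C)`. Hence `p`, `q`, `r`, the normalized values of consecutive pairs,
determine all pairs additively. One further parameter `s` for `bcd/abc` fixes the remaining triples,
and the eight cross-ratios become the arguments of `ell_octagon`. -/
theorem ell_octagon_of_rel {A B C E ab ac ad bc bd cd abc abd acd bcd : ℝ}
    (hA : 0 < A) (hB : 0 < B) (hC : 0 < C) (hE : 0 < E)
    (hab : 0 < ab) (hbc : 0 < bc) (hcd : 0 < cd)
    (habc : 0 < abc) (hbcd : 0 < bcd)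
    (r1 : ac * B = ab * C + bc * A) (r2 : bd * C = bc * E + cd * B)
    (r3 : ad * C = ac * E + cd * A)
    (r4 : abd * bc = abc * bd + bcd * ab) (r5 : acd * bc = abc * cd + bcd * ac) :
    ell (ad * bcd / (abd * cd)) + ell (A * bd / (ab * E)) + ell (ab * bcd / (abc * bd)) +
        ell (B * cd / (bc * E)) =
      ell (A * bc / (ab * C)) + ell (ac * bcd / (abc * cd)) + ell (A * cd / (ac * E)) +
        ell (ab * acd / (abc * ad)) := by
  obtain ⟨p, rfl⟩ : ∃ p, ab = p * A * B := ⟨ab / (A * B), by field_simp⟩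
  obtain ⟨q, rfl⟩ : ∃ q, bc = q * B * C := ⟨bc / (B * C), by field_simp⟩
  obtain ⟨r, rfl⟩ : ∃ r, cd = r * C * E := ⟨cd / (C * E), by field_simp⟩
  obtain ⟨s, rfl⟩ : ∃ s, bcd = abc * (s * E / A) := ⟨bcd * A / (abc * E), by field_simp⟩
  have hp : 0 < p := by
    exact pos_of_mul_pos_left (pos_of_mul_pos_left hab hB.le) hA.le
  have hq : 0 < q := pos_of_mul_pos_left (pos_of_mul_pos_left hbc hC.le) hB.le
  have hr : 0 < r := pos_of_mul_pos_left (pos_of_mul_pos_left hcd hE.le) hC.le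
  have hs : 0 < s := by
    have h1 := pos_of_mul_pos_right hbcd habc.le
    have h2 : s = s * E / A * (A / E) := by field_simp
    rw [h2]; positivity
  obtain rfl : ac = (p + q) * A * C := by
    apply mul_right_cancel₀ hB.ne'; rw [r1]; ring
  obtain rfl : bd = (q + r) * B * E := by
    apply mul_right_cancel₀ hC.ne'; rw [r2]; ring
  obtain rfl : ad = (p + q + r) * A * E := by
    apply mul_right_cancel₀ hC.ne'; rw [r3]; ring
  obtain rfl : abd = abc * E * (q + r + s * p) / (q * C) := by
    apply mul_right_cancel₀ hbc.ne'; rw [r4]; field_simp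
  obtain rfl : acd = abc * E * (r + s * (p + q)) / (q * B) := by
    apply mul_right_cancel₀ hbc.ne'; rw [r5]; field_simp
  have t1 : (p + q + r) * A * E * (abc * (s * E / A)) /
      (abc * E * (q + r + s * p) / (q * C) * (r * C * E)) =
      s * (p + q + r) * q / ((q + r + s * p) * r) := by field_simp
  have t2 : A * ((q + r) * B * E) / (p * A * B * E) = (q + r) / p := by field_simp
  have t3 : p * A * B * (abc * (s * E / A)) / (abc * ((q + r) * B * E)) = p * s / (q + r) := by
    field_simp
  have t4 : B * (r * C * E) / (q * B * C * E) = r / q := by field_simp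
  have t5 : A * (q * B * C) / (p * A * B * C) = q / p := by field_simp
  have t6 : (p + q) * A * C * (abc * (s * E / A)) / (abc * (r * C * E)) = (p + q) * s / r := by
    field_simp
  have t7 : A * (r * C * E) / ((p + q) * A * C * E) = r / (p + q) := by field_simp
  have t8 : p * A * B * (abc * E * (r + s * (p + q)) / (q * B)) /
      (abc * ((p + q + r) * A * E)) = p * (r + s * (p + q)) / (q * (p + q + r)) := by
    field_simp
  rw [t1, t2, t3, t4, t5, t6, t7, t8]
  exact ell_octagon hp hq hr hs

theorem crossY_octagon {n : ℕ} {D : Set ℕ → ℝ} (hD : IsFlagLike n D) {J : Set ℕ} {a b c d : ℕ}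
    (ha : 1 ≤ a) (hab : a < b) (hbc : b < c) (hcd : c < d) (hd : d ≤ n)
    (aJ : a ∉ J) (bJ : b ∉ J) (cJ : c ∉ J) (dJ : d ∉ J) :
    ell (crossY D (insert d J) a b c) + ell (crossY D J a b d) +
        ell (crossY D (insert b J) a c d) + ell (crossY D J b c d) =
      ell (crossY D J a b c) + ell (crossY D (insert c J) a b d) + ell (crossY D J a c d) +
        ell (crossY D (insert a J) b c d) := by
  have r1 := hD.rel J a b c ha hab hbc (by omega) aJ bJ cJ
  have r2 := hD.rel J b c d (by omega) hbc hcd hd bJ cJ dJ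
  have r3 := hD.rel J a c d ha (by omega) hcd hd aJ cJ dJ
  have r4 := hD.rel (insert b J) a c d ha (by omega) hcd hd
    (by simp [aJ]; omega) (by simp [cJ]; omega) (by simp [dJ]; omega)
  have r5 := hD.rel (insert c J) a b d ha (by omega) (by omega) hd
    (by simp [aJ]; omega) (by simp [bJ]; omega) (by simp [dJ]; omega)
  have eb : ∀ S : Set ℕ, insert b (insert a S) = insert a (insert b S) :=
    fun S => Set.insert_comm _ _ _
  have ec : ∀ S : Set ℕ, insert c (insert a S) = insert a (insert c S) :=
    fun S => Set.insert_comm _ _ _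
  have ed : ∀ S : Set ℕ, insert d (insert a S) = insert a (insert d S) :=
    fun S => Set.insert_comm _ _ _
  have fc : ∀ S : Set ℕ, insert c (insert b S) = insert b (insert c S) :=
    fun S => Set.insert_comm _ _ _
  have fd : ∀ S : Set ℕ, insert d (insert b S) = insert b (insert d S) :=
    fun S => Set.insert_comm _ _ _
  have gd : ∀ S : Set ℕ, insert d (insert c S) = insert c (insert d S) :=
    fun S => Set.insert_comm _ _ _
  simp only [fc, fd, gd] at r4 r5
  simp only [crossY, eb, ec, ed, fc, fd, gd]
  exact ell_octagon_of_rel (hD.pos _) (hD.pos _) (hD.pos _) (hD.pos _) (hD.pos _) (hD.pos _)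
    (hD.pos _) (hD.pos _) (hD.pos _) r1 r2 r3 (by linear_combination r4)
    (by linear_combination r5)

/-- Stage `w` of the interpolation between the base set `{i | a < i < b ∨ c < i}` (at `w ≤ 1`)
and the base set `{i | i < a ∨ b < i < c}` (at large `w`). -/
def stage (a b c w : ℕ) : Set ℕ :=
  {i | (i < w ∧ (i < a ∨ b < i ∧ i < c)) ∨ (w ≤ i ∧ (a < i ∧ i < b ∨ c < i))}

theorem ell_stage_octagon {n : ℕ} {D : Set ℕ → ℝ} (hD : IsFlagLike n D) {a b c d : ℕ}
    (ha : 1 ≤ a) (hab : a < b) (hbc : b < c) (hcd : c < d) (hd : d ≤ n) :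
    (ell (crossY D (stage b c d a) b c d) - ell (crossY D (stage b c d (a + 1)) b c d)) +
      (ell (crossY D (stage a c d b) a c d) - ell (crossY D (stage a c d (b + 1)) a c d)) +
      (ell (crossY D (stage a b d c) a b d) - ell (crossY D (stage a b d (c + 1)) a b d)) +
      (ell (crossY D (stage a b c d) a b c) - ell (crossY D (stage a b c (d + 1)) a b c)) = 0 := by
  -- This one set serves all four triples: away from the quadruple, every stage involved agrees with
  -- it, so each stage is `J` or `J` with the fourth index adjoined.
  obtain ⟨J, hJ⟩ : ∃ J : Set ℕ, ∀ i, i ∈ J ↔ (i < a ∨ b < i ∧ i < c ∨ d < i) :=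
    ⟨{i | i < a ∨ b < i ∧ i < c ∨ d < i}, fun i => Iff.rfl⟩
  have s1 : stage b c d a = J := by ext i; simp only [stage, Set.mem_ofPred_eq, hJ]; omega
  have s2 : stage b c d (a + 1) = insert a J := by
    ext i; simp only [stage, Set.mem_ofPred_eq, Set.mem_insert_iff, hJ]; omega
  have s3 : stage a c d b = insert b J := by
    ext i; simp only [stage, Set.mem_ofPred_eq, Set.mem_insert_iff, hJ]; omega
  have s4 : stage a c d (b + 1) = J := by ext i; simp only [stage, Set.mem_ofPred_eq, hJ]; omega
  have s5 : stage a b d c = J := by ext i; simp only [stage, Set.mem_ofPred_eq, hJ]; omega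
  have s6 : stage a b d (c + 1) = insert c J := by
    ext i; simp only [stage, Set.mem_ofPred_eq, Set.mem_insert_iff, hJ]; omega
  have s7 : stage a b c d = insert d J := by
    ext i; simp only [stage, Set.mem_ofPred_eq, Set.mem_insert_iff, hJ]; omega
  have s8 : stage a b c (d + 1) = J := by ext i; simp only [stage, Set.mem_ofPred_eq, hJ]; omega
  rw [s1, s2, s3, s4, s5, s6, s7, s8]
  linarith [crossY_octagon hD ha hab hbc hcd hd (J := J) (by rw [hJ]; omega) (by rw [hJ]; omega)
    (by rw [hJ]; omega) (by rw [hJ]; omega)]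

theorem mem_tetra {n : ℕ} {t : ℕ × ℕ × ℕ} :
    t ∈ tetra n ↔ 1 ≤ t.1 ∧ t.1 < t.2.1 ∧ t.2.1 < t.2.2 ∧ t.2.2 ≤ n := by
  simp only [tetra, Finset.mem_filter, Finset.mem_product, Finset.mem_Icc]
  omega

/-- A sum over triples and a further index, vanishing when the index lies in the triple, is a sum
over increasing quadruples. -/
theorem sum_tetra_Icc (n : ℕ) (g : ℕ → ℕ → ℕ → ℕ → ℝ)
    (hg : ∀ x y z w, x < y → y < z → w = x ∨ w = y ∨ w = z → g x y z w = 0) :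
    ∑ t ∈ tetra n, ∑ w ∈ Finset.Icc 1 n, g t.1 t.2.1 t.2.2 w =
      ∑ q ∈ (tetra n ×ˢ Finset.Icc 1 n).filter (fun q => q.1.2.2 < q.2),
        (g q.1.2.1 q.1.2.2 q.2 q.1.1 + g q.1.1 q.1.2.2 q.2 q.1.2.1 +
          g q.1.1 q.1.2.1 q.2 q.1.2.2 + g q.1.1 q.1.2.1 q.1.2.2 q.2) := by
  rw [← Finset.sum_product (tetra n) (Finset.Icc 1 n) fun p => g p.1.1 p.1.2.1 p.1.2.2 p.2]
  -- The further index has four possible positions relative to the triple; sorting the four numbers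
  -- matches each case bijectively with the increasing quadruples.
  have hsplit : ∀ p ∈ tetra n ×ˢ Finset.Icc 1 n, g p.1.1 p.1.2.1 p.1.2.2 p.2 =
      (if p.2 < p.1.1 then g p.1.1 p.1.2.1 p.1.2.2 p.2 else 0) +
      (if p.1.1 < p.2 ∧ p.2 < p.1.2.1 then g p.1.1 p.1.2.1 p.1.2.2 p.2 else 0) +
      (if p.1.2.1 < p.2 ∧ p.2 < p.1.2.2 then g p.1.1 p.1.2.1 p.1.2.2 p.2 else 0) +
      (if p.1.2.2 < p.2 then g p.1.1 p.1.2.1 p.1.2.2 p.2 else 0) := by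
    rintro ⟨⟨x, y, z⟩, w⟩ hp
    obtain ⟨-, hxy, hyz, -⟩ := mem_tetra.1 (Finset.mem_product.1 hp).1
    dsimp only at hxy hyz ⊢
    by_cases h : w = x ∨ w = y ∨ w = z
    · simp [hg x y z w hxy hyz h]
    · have : w < x ∨ (x < w ∧ w < y) ∨ (y < w ∧ w < z) ∨ z < w := by omega
      rcases this with h | h | h | h
      · rw [if_pos h, if_neg (by omega), if_neg (by omega), if_neg (by omega)]; ring
      · rw [if_neg (by omega), if_pos h, if_neg (by omega), if_neg (by omega)]; ring
      · rw [if_neg (by omega), if_neg (by omega), if_pos h, if_neg (by omega)]; ring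
      · rw [if_neg (by omega), if_neg (by omega), if_neg (by omega), if_pos h]; ring
  rw [Finset.sum_congr rfl hsplit]
  simp only [Finset.sum_add_distrib, ← Finset.sum_filter]
  congr 1
  congr 1
  congr 1
  · refine Finset.sum_nbij' (fun p => ((p.2, p.1.1, p.1.2.1), p.1.2.2))
      (fun q => ((q.1.2.1, q.1.2.2, q.2), q.1.1)) ?_ ?_ ?_ ?_ ?_ <;>
    simp only [Finset.mem_filter, Finset.mem_product, mem_tetra, Finset.mem_Icc,
      Prod.mk.eta, implies_true]
    all_goals intro p hp; omega
  · refine Finset.sum_nbij' (fun p => ((p.1.1, p.2, p.1.2.1), p.1.2.2))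
      (fun q => ((q.1.1, q.1.2.2, q.2), q.1.2.1)) ?_ ?_ ?_ ?_ ?_ <;>
    simp only [Finset.mem_filter, Finset.mem_product, mem_tetra, Finset.mem_Icc,
      Prod.mk.eta, implies_true]
    all_goals intro p hp; omega
  · refine Finset.sum_nbij' (fun p => ((p.1.1, p.1.2.1, p.2), p.1.2.2))
      (fun q => ((q.1.1, q.1.2.1, q.2), q.1.2.2)) ?_ ?_ ?_ ?_ ?_ <;>
    simp only [Finset.mem_filter, Finset.mem_product, mem_tetra, Finset.mem_Icc,
      Prod.mk.eta, implies_true]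
    all_goals intro p hp; omega

theorem sum_ell_crossY {n : ℕ} {D : Set ℕ → ℝ} (hD : IsFlagLike n D) :
    ∑ t ∈ tetra n, ell (crossY D {i | t.1 < i ∧ i < t.2.1 ∨ t.2.2 < i} t.1 t.2.1 t.2.2) =
      ∑ t ∈ tetra n, ell (crossY D {i | i < t.1 ∨ t.2.1 < i ∧ i < t.2.2} t.1 t.2.1 t.2.2) := by
  have hcongr : ∀ (S T : Set ℕ) (a b c : ℕ), (∀ i, 1 ≤ i → i ≤ n → (i ∈ S ↔ i ∈ T)) →
      crossY D S a b c = crossY D T a b c := by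
    intro S T a b c h
    have h' : ∀ U V : Set ℕ, (∀ i, 1 ≤ i → i ≤ n → (i ∈ U ↔ i ∈ V)) → ∀ x i, 1 ≤ i → i ≤ n →
        (i ∈ insert x U ↔ i ∈ insert x V) := by
      intro U V hUV x i h1 h2
      rw [Set.mem_insert_iff, Set.mem_insert_iff, hUV i h1 h2]
    unfold crossY
    rw [hD.congr _ _ (h' S T h a), hD.congr _ _ (h' S T h c),
      hD.congr _ _ (h' _ _ (h' S T h c) b), hD.congr _ _ (h' _ _ (h' S T h b) a)]
  set g : ℕ → ℕ → ℕ → ℕ → ℝ := fun x y z w =>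
    ell (crossY D (stage x y z w) x y z) - ell (crossY D (stage x y z (w + 1)) x y z) with hgdef
  have hzero : ∑ t ∈ tetra n, ∑ w ∈ Finset.Icc 1 n, g t.1 t.2.1 t.2.2 w = 0 := by
    rw [sum_tetra_Icc n g]
    · refine Finset.sum_eq_zero fun q hq => ?_
      simp only [Finset.mem_filter, Finset.mem_product, mem_tetra, Finset.mem_Icc] at hq
      obtain ⟨⟨⟨h1, h2, h3, h4⟩, h5, h6⟩, h7⟩ := hq
      exact ell_stage_octagon hD h1 h2 h3 h7 h6
    · intro x y z w hxy hyz hw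
      -- Successive stages can differ only at the element `w`, and no stage contains an index of its
      -- own triple.
      have : stage x y z w = stage x y z (w + 1) := by
        ext i; simp only [stage, Set.mem_ofPred_eq]; omega
      simp only [hgdef, this, sub_self]
  rw [← sub_eq_zero, ← Finset.sum_sub_distrib, ← hzero]
  refine Finset.sum_congr rfl fun t ht => ?_
  obtain ⟨h1, h2, h3, h4⟩ := mem_tetra.1 ht
  rw [show Finset.Icc 1 n = Finset.Ico 1 (n + 1) from rfl, Finset.sum_Ico_eq_sum_range]
  have := Finset.sum_range_sub' (fun w => ell (crossY D (stage t.1 t.2.1 t.2.2 (1 + w))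
    t.1 t.2.1 t.2.2)) n
  simp only [hgdef, Nat.add_sub_cancel, add_assoc]
  rw [this]
  -- The telescope runs from stage `1` to stage `n + 1`; within `[1, n]` these are exactly the two
  -- desired base sets.
  congr 2 <;> refine hcongr _ _ _ _ _ fun i hi hin => ?_ <;>
    simp only [stage, Set.mem_ofPred_eq] <;> omega


/-! ### Three-term Plücker relations for flag minors. -/

theorem det_submatrix_insertNth {n k : ℕ} (A : Matrix (Fin n) (Fin n) ℝ) (p : Fin (k + 1))
    (x : Fin n) (r : Fin k → Fin n) (col : Fin (k + 1) → Fin n) :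
    (A.submatrix (p.insertNth x r : Fin (k + 1) → Fin n) col).det =
      (-1) ^ (p : ℕ) * (A.submatrix (Fin.cons x r : Fin (k + 1) → Fin n) col).det := by
  rw [← Fin.cons_comp_cycleRange]
  have := Matrix.det_permute p.cycleRange (A.submatrix (Fin.cons x r : Fin (k + 1) → Fin n) col)
  rw [Matrix.submatrix_submatrix, Function.comp_id] at this
  rw [this, Fin.sign_cycleRange]
  simp

theorem det_submatrix_cons_swap {n k : ℕ} (A : Matrix (Fin n) (Fin n) ℝ)
    (x y : Fin n) (r : Fin k → Fin n) (col : Fin (k + 2) → Fin n) :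
    (A.submatrix (Fin.cons x (Fin.cons y r : Fin (k + 1) → Fin n) : Fin (k + 2) → Fin n) col).det =
      -(A.submatrix (Fin.cons y (Fin.cons x r : Fin (k + 1) → Fin n) :
        Fin (k + 2) → Fin n) col).det := by
  have h := det_submatrix_insertNth A (Fin.succ 0) x (Fin.cons y r : Fin (k + 1) → Fin n) col
  rw [Fin.insertNth_succ_cons, Fin.insertNth_zero'] at h
  rw [h]
  simp

/-- The three-term Plücker relation between minors with rows containing `r`. -/
theorem det_submatrix_three_term {n m : ℕ} (A : Matrix (Fin n) (Fin n) ℝ) (a b c : Fin n)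
    (r : Fin m → Fin n) (col : Fin (m + 2) → Fin n) (j : Fin (m + 2)) :
    (A.submatrix (Fin.cons a (Fin.cons c r : Fin (m + 1) → Fin n) : Fin (m + 2) → Fin n) col).det *
        (A.submatrix (Fin.cons b r : Fin (m + 1) → Fin n) (col ∘ j.succAbove)).det =
      (A.submatrix (Fin.cons a (Fin.cons b r : Fin (m + 1) → Fin n) :
          Fin (m + 2) → Fin n) col).det *
        (A.submatrix (Fin.cons c r : Fin (m + 1) → Fin n) (col ∘ j.succAbove)).det +
      (A.submatrix (Fin.cons b (Fin.cons c r : Fin (m + 1) → Fin n) :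
          Fin (m + 2) → Fin n) col).det *
        (A.submatrix (Fin.cons a r : Fin (m + 1) → Fin n) (col ∘ j.succAbove)).det := by
  set lam : Fin n → ℝ := fun x =>
    (A.submatrix (Fin.cons x r : Fin (m + 1) → Fin n) (col ∘ j.succAbove)).det with hlam
  set R : Fin (m + 3) → Fin n :=
    Fin.cons a (Fin.cons b (Fin.cons c r : Fin (m + 1) → Fin n) : Fin (m + 2) → Fin n) with hR
  set B : Matrix (Fin (m + 3)) (Fin (m + 3)) ℝ :=
    Matrix.of fun i => Fin.cons (lam (R i)) (fun k => A (R i) (col k)) with hB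
  -- Laplace expansion along the row `x` makes `lam` a linear combination of the columns `col`, with
  -- coefficient zero at the omitted column `j`. So the bordered matrix `B` is singular. Expanding
  -- it along the `lam` column leaves only the rows `a`, `b`, `c`, because `lam` vanishes on the
  -- rows `r` by repetition.
  obtain ⟨w, hw⟩ : ∃ w : Fin (m + 2) → ℝ, ∀ x, lam x = ∑ k, A x (col k) * w k := by
    refine ⟨j.insertNth 0 fun k => (-1) ^ (k : ℕ) *
      (A.submatrix r (col ∘ j.succAbove ∘ k.succAbove)).det, fun x => ?_⟩
    rw [Fin.sum_univ_succAbove _ j, hlam]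
    simp only [Fin.insertNth_apply_same, mul_zero, zero_add, Fin.insertNth_apply_succAbove]
    rw [Matrix.det_succ_row_zero]
    refine Finset.sum_congr rfl fun k _ => ?_
    have : (A.submatrix (Fin.cons x r : Fin (m + 1) → Fin n) (col ∘ j.succAbove)).submatrix
        Fin.succ k.succAbove = A.submatrix r (col ∘ j.succAbove ∘ k.succAbove) := by
      ext p q; simp
    rw [this]
    simp only [Matrix.submatrix_apply, Fin.cons_zero, Function.comp_apply]
    ring
  have hdet : B.det = 0 := by
    refine Matrix.exists_mulVec_eq_zero_iff.1 ⟨Fin.cons (-1) w, ?_, ?_⟩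
    · intro h
      have := congrFun h 0
      simp at this
    · ext i
      simp [Matrix.mulVec, dotProduct, Fin.sum_univ_succ, hB, hw]
  have hzero : ∀ i, lam (r i) = 0 := by
    intro i
    refine Matrix.det_zero_of_row_eq (i := 0) (j := i.succ) (Fin.succ_ne_zero i).symm ?_
    ext k
    simp
  have hsub : ∀ (i : Fin (m + 3)), B.submatrix i.succAbove Fin.succ =
      A.submatrix (R ∘ i.succAbove) col := by
    intro i; ext p q; simp [hB]
  have hB0 : ∀ i, B i 0 = lam (R i) := by intro i; simp [hB]
  rw [Matrix.det_succ_column_zero, Fin.sum_univ_succ, Fin.sum_univ_succ, Fin.sum_univ_succ] at hdet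
  simp only [hsub, hB0] at hdet
  have e0 : R ∘ (0 : Fin (m + 3)).succAbove =
      Fin.cons b (Fin.cons c r : Fin (m + 1) → Fin n) := by
    ext i; simp [hR]
  have e1 : R ∘ (Fin.succ 0 : Fin (m + 3)).succAbove =
      Fin.cons a (Fin.cons c r : Fin (m + 1) → Fin n) := by
    ext i; refine Fin.cases ?_ (fun i => ?_) i <;> simp [hR]
  have e2 : R ∘ (Fin.succ (Fin.succ 0) : Fin (m + 3)).succAbove =
      Fin.cons a (Fin.cons b r : Fin (m + 1) → Fin n) := by
    ext i
    refine Fin.cases ?_ (fun i => ?_) i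
    · simp only [hR, Function.comp_apply, Fin.succ_succAbove_zero, Fin.cons_zero]
    · refine Fin.cases ?_ (fun i => ?_) i <;>
      simp only [hR, Function.comp_apply, Fin.succ_succAbove_zero, Fin.succ_succAbove_succ,
        Fin.cons_zero, Fin.cons_succ, Fin.succAbove_zero]
  have e3 : ∀ i : Fin m, R (Fin.succ (Fin.succ (Fin.succ i))) = r i := by
    intro i; simp [hR]
  rw [e0, e1, e2] at hdet
  simp only [e3, hzero, mul_zero, zero_mul, Finset.sum_const_zero] at hdet
  simp only [hR, hlam, Fin.cons_zero, Fin.cons_succ, Fin.val_zero, Fin.val_succ] at hdet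
  linear_combination -hdet

theorem orderEmbOfFin_insert {n m : ℕ} {I : Finset (Fin n)} (hI : I.card = m) {x : Fin n}
    (hx : x ∉ I) (h : (insert x I).card = m + 1) :
    ∃ p : Fin (m + 1), (p : ℕ) = (I.filter (· < x)).card ∧
      ⇑((insert x I).orderEmbOfFin h) = p.insertNth x (I.orderEmbOfFin hI) := by
  set e := I.orderEmbOfFin hI with he
  have hp : (I.filter (· < x)).card < m + 1 := by
    have := Finset.card_filter_le I (· < x); omega
  refine ⟨⟨_, hp⟩, rfl, ?_⟩
  symm
  refine Finset.orderEmbOfFin_unique h ?_ ?_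
  · intro i
    refine Fin.succAboveCases ⟨_, hp⟩ ?_ (fun i => ?_) i
    · simp
    · rw [Fin.insertNth_apply_succAbove]
      exact Finset.mem_insert_of_mem (I.orderEmbOfFin_mem hI i)
  · rw [Fin.strictMono_insertNth_iff]
    refine ⟨e.strictMono, fun i hi => ?_, fun i hi => ?_⟩
    · by_contra hlt
      have hsub : I.filter (· < x) ⊆ (Finset.Iio i).image e := by
        intro y hy
        obtain ⟨hyI, hyx⟩ := Finset.mem_filter.1 hy
        obtain ⟨k, rfl⟩ : y ∈ Set.range e := by
          rw [he, Finset.range_orderEmbOfFin]; exact hyI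
        exact Finset.mem_image_of_mem _
          (Finset.mem_Iio.2 (e.lt_iff_lt.1 (hyx.trans_le (not_lt.1 hlt))))
      have := (Finset.card_le_card hsub).trans Finset.card_image_le
      rw [Fin.card_Iio] at this
      rw [Fin.lt_def] at hi
      simp only [Fin.val_castSucc] at hi
      omega
    · have hne : e i ≠ x := fun h => hx (h ▸ I.orderEmbOfFin_mem hI i)
      by_contra hlt
      have hlt' : e i < x := lt_of_le_of_ne (not_lt.1 hlt) hne
      have hsub : (Finset.Iic i).image e ⊆ I.filter (· < x) := by
        intro y hy
        obtain ⟨k, hk, rfl⟩ := Finset.mem_image.1 hy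
        exact Finset.mem_filter.2 ⟨I.orderEmbOfFin_mem hI k,
          (e.monotone (Finset.mem_Iic.1 hk)).trans_lt hlt'⟩
      have := Finset.card_le_card hsub
      rw [Finset.card_image_of_injective _ e.injective, Fin.card_Iic] at this
      rw [Fin.le_def] at hi
      simp only [Fin.val_castSucc] at hi
      omega

theorem det_submatrix_insert {n m : ℕ} (A : Matrix (Fin n) (Fin n) ℝ) {I : Finset (Fin n)}
    (hI : I.card = m) {x : Fin n} (hx : x ∉ I) (h : (insert x I).card = m + 1)
    (col : Fin (m + 1) → Fin n) :
    (A.submatrix ((insert x I).orderEmbOfFin h) col).det = (-1) ^ (I.filter (· < x)).card *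
      (A.submatrix (Fin.cons x (I.orderEmbOfFin hI) : Fin (m + 1) → Fin n) col).det := by
  obtain ⟨p, hp, hpe⟩ := orderEmbOfFin_insert hI hx h
  rw [hpe, det_submatrix_insertNth, hp]

theorem det_submatrix_insert_insert {n m : ℕ} (A : Matrix (Fin n) (Fin n) ℝ)
    {I : Finset (Fin n)} (hI : I.card = m) {x y : Fin n} (hxy : x < y) (hx : x ∉ I) (hy : y ∉ I)
    (h : (insert x (insert y I)).card = m + 2) (col : Fin (m + 2) → Fin n) :
    (A.submatrix ((insert x (insert y I)).orderEmbOfFin h) col).det =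
      (-1) ^ (I.filter (· < x)).card * (-1) ^ (I.filter (· < y)).card *
      (A.submatrix (Fin.cons x (Fin.cons y (I.orderEmbOfFin hI) : Fin (m + 1) → Fin n) :
        Fin (m + 2) → Fin n) col).det := by
  have hyI : (insert y I).card = m + 1 := by rw [Finset.card_insert_of_notMem hy, hI]
  have hx' : x ∉ insert y I := by simp [hx, hxy.ne]
  rw [det_submatrix_insert A hyI hx' h, Finset.filter_insert, if_neg hxy.not_gt]
  obtain ⟨p, hp, hpe⟩ := orderEmbOfFin_insert hI hy hyI
  rw [hpe, ← Fin.insertNth_succ_cons, det_submatrix_insertNth, det_submatrix_cons_swap,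
    Fin.val_succ, hp]
  ring

/-- Sorting the rows costs one sign for each of `a`, `b`, `c`, given by the number of elements of
`I` below it. Each of the three products involves all three indices once, so the signs agree and
factor out. -/
theorem minor_three_term {n m : ℕ} (A : Matrix (Fin n) (Fin n) ℝ) {I : Finset (Fin n)}
    (hI : I.card = m) {a b c : Fin n} (hab : a < b) (hbc : b < c) (ha : a ∉ I) (hb : b ∉ I)
    (hc : c ∉ I) (hac' : (insert a (insert c I)).card = m + 2)
    (hab' : (insert a (insert b I)).card = m + 2) (hbc' : (insert b (insert c I)).card = m + 2)
    (ha' : (insert a I).card = m + 1) (hb' : (insert b I).card = m + 1)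
    (hc' : (insert c I).card = m + 1) (col : Fin (m + 2) → Fin n) (col' : Fin (m + 1) → Fin n)
    (j : Fin (m + 2)) (hj : col ∘ j.succAbove = col') :
    (A.submatrix ((insert a (insert c I)).orderEmbOfFin hac') col).det *
        (A.submatrix ((insert b I).orderEmbOfFin hb') col').det =
      (A.submatrix ((insert a (insert b I)).orderEmbOfFin hab') col).det *
        (A.submatrix ((insert c I).orderEmbOfFin hc') col').det +
      (A.submatrix ((insert b (insert c I)).orderEmbOfFin hbc') col).det *
        (A.submatrix ((insert a I).orderEmbOfFin ha') col').det := by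
  subst hj
  rw [det_submatrix_insert_insert A hI (hab.trans hbc) ha hc,
    det_submatrix_insert_insert A hI hab ha hb, det_submatrix_insert_insert A hI hbc hb hc,
    det_submatrix_insert A hI ha, det_submatrix_insert A hI hb, det_submatrix_insert A hI hc]
  linear_combination ((-1) ^ (I.filter (· < a)).card * (-1) ^ (I.filter (· < b)).card *
    (-1) ^ (I.filter (· < c)).card) *
    det_submatrix_three_term A a b c (I.orderEmbOfFin hI) col j

theorem rightMinor_eq {n k : ℕ} (M : Matrix (Fin n) (Fin n) ℝ) {I : Finset (Fin n)}
    (h : I.card = k) (hk : k ≤ n) :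
    rightMinor M I = (M.submatrix (I.orderEmbOfFin h) (lastEmb hk)).det := by
  subst h; rfl

theorem upperMinor_eq {n k : ℕ} (M : Matrix (Fin n) (Fin n) ℝ) {I : Finset (Fin n)}
    (h : I.card = k) (hk : k ≤ n) :
    upperMinor M I = (M.transpose.submatrix (I.orderEmbOfFin h) (firstEmb hk)).det := by
  subst h
  rw [← Matrix.det_transpose]
  rfl

theorem card_insert_insert {n : ℕ} {I : Finset (Fin n)} {x y : Fin n} (hxy : x < y) (hx : x ∉ I)
    (hy : y ∉ I) : (insert x (insert y I)).card = I.card + 2 := by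
  rw [Finset.card_insert_of_notMem (by simp [hx, hxy.ne]), Finset.card_insert_of_notMem hy]

theorem rightMinor_three_term {n : ℕ} (M : Matrix (Fin n) (Fin n) ℝ) {I : Finset (Fin n)}
    {a b c : Fin n} (hab : a < b) (hbc : b < c) (ha : a ∉ I) (hb : b ∉ I) (hc : c ∉ I) :
    rightMinor M (insert a (insert c I)) * rightMinor M (insert b I) =
      rightMinor M (insert a (insert b I)) * rightMinor M (insert c I) +
      rightMinor M (insert b (insert c I)) * rightMinor M (insert a I) := by
  have h2 := card_insert_insert hab ha hb
  have hn : I.card + 2 ≤ n := h2 ▸ card_le _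
  rw [rightMinor_eq M (card_insert_insert (hab.trans hbc) ha hc) hn, rightMinor_eq M h2 hn,
    rightMinor_eq M (card_insert_insert hbc hb hc) hn,
    rightMinor_eq M (Finset.card_insert_of_notMem ha) (by omega),
    rightMinor_eq M (Finset.card_insert_of_notMem hb) (by omega),
    rightMinor_eq M (Finset.card_insert_of_notMem hc) (by omega)]
  -- Passing to one fewer of the last columns drops the first of them; for upper minors the last
  -- column is dropped instead.
  refine minor_three_term M rfl hab hbc ha hb hc _ _ _ _ _ _ _ _ 0 ?_
  ext i
  change n - (I.card + 2) + ((0 : Fin (I.card + 2)).succAbove i : ℕ) = n - (I.card + 1) + i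
  rw [Fin.succAbove_zero, Fin.val_succ]
  omega

theorem upperMinor_three_term {n : ℕ} (M : Matrix (Fin n) (Fin n) ℝ) {I : Finset (Fin n)}
    {a b c : Fin n} (hab : a < b) (hbc : b < c) (ha : a ∉ I) (hb : b ∉ I) (hc : c ∉ I) :
    upperMinor M (insert a (insert c I)) * upperMinor M (insert b I) =
      upperMinor M (insert a (insert b I)) * upperMinor M (insert c I) +
      upperMinor M (insert b (insert c I)) * upperMinor M (insert a I) := by
  have h2 := card_insert_insert hab ha hb
  have hn : I.card + 2 ≤ n := h2 ▸ card_le _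
  rw [upperMinor_eq M (card_insert_insert (hab.trans hbc) ha hc) hn, upperMinor_eq M h2 hn,
    upperMinor_eq M (card_insert_insert hbc hb hc) hn,
    upperMinor_eq M (Finset.card_insert_of_notMem ha) (by omega),
    upperMinor_eq M (Finset.card_insert_of_notMem hb) (by omega),
    upperMinor_eq M (Finset.card_insert_of_notMem hc) (by omega)]
  refine minor_three_term M.transpose rfl hab hbc ha hb hc _ _ _ _ _ _ _ _ (Fin.last _) ?_
  ext i
  change ((Fin.last (I.card + 1)).succAbove i : ℕ) = i
  rw [Fin.succAbove_last, Fin.val_castSucc]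

/-! ### Positivity of flag minors. -/

/-- Adding `s` to the identity matrix at the positions `(r t, c t)` keeps it upper triangular, and
invertible for `s > 0`. The selected submatrix becomes `P + s`, whose determinant is the
characteristic polynomial of `-P` at `s`; any positive non-root gives a nonzero minor. -/
theorem not_vanishesIdentically {n k : ℕ} (r c : Fin k ↪o Fin n) (h : ∀ i, r i ≤ c i) :
    ¬ VanishesIdentically r c := by
  classical
  intro hv
  set P : Matrix (Fin k) (Fin k) ℝ := (1 : Matrix (Fin n) (Fin n) ℝ).submatrix r c with hP
  obtain ⟨s, hs, hsP⟩ := (Set.Ioi_infinite (0 : ℝ)).exists_notMem_finset (-P).charpoly.roots.toFinset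
  have hs0 : (0 : ℝ) < s := hs
  have hne : (Matrix.scalar (Fin k) s - -P).det ≠ 0 := by
    intro h0
    rw [← Matrix.eval_charpoly] at h0
    exact hsP (Multiset.mem_toFinset.2
      ((Polynomial.mem_roots (Matrix.charpoly_monic _).ne_zero).2 h0))
  set H : Matrix (Fin n) (Fin n) ℝ :=
    Matrix.of fun i j => (1 : Matrix (Fin n) (Fin n) ℝ) i j +
      if ∃ t, r t = i ∧ c t = j then s else 0 with hH
  have hlow : ∀ i j : Fin n, j < i → H i j = 0 := by
    intro i j hij
    have : ¬ ∃ t, r t = i ∧ c t = j := by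
      rintro ⟨t, rfl, rfl⟩
      exact absurd (h t) (not_le.2 hij)
    simp [hH, this, Matrix.one_apply_ne hij.ne']
  have hinv : IsInvUpper H := by
    refine ⟨hlow, ?_⟩
    rw [Matrix.det_of_isUpperTriangular (fun i j hij => hlow i j hij), isUnit_iff_ne_zero,
      Finset.prod_ne_zero_iff]
    intro i _
    simp only [hH, Matrix.of_apply, Matrix.one_apply_eq]
    split_ifs <;> linarith
  refine hne ?_
  rw [← hv H hinv, minor]
  congr 1
  ext i j
  have : (∃ t, r t = r i ∧ c t = c j) ↔ i = j :=
    ⟨fun ⟨t, h1, h2⟩ => (r.injective h1).symm.trans (c.injective h2), fun h => ⟨i, rfl, by rw [h]⟩⟩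
  simp [hH, hP, Matrix.diagonal_apply, add_comm]

theorem val_le_of_strictMono {n k : ℕ} {e : Fin k → Fin n} (he : StrictMono e) (i : Fin k) :
    (i : ℕ) ≤ e i := by
  obtain ⟨i, hi⟩ := i
  induction i with
  | zero => simp
  | succ i ih =>
    have h1 := ih (by omega)
    have h2 : e ⟨i, by omega⟩ < e ⟨i + 1, hi⟩ := he (by simp)
    rw [Fin.lt_def] at h2
    dsimp only at h1 ⊢
    omega

theorem rightMinor_pos {n : ℕ} {M : Matrix (Fin n) (Fin n) ℝ} (hM : IsTotallyPositive M)
    (I : Finset (Fin n)) : 0 < rightMinor M I := by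
  refine hM.2 _ _ _ (not_vanishesIdentically _ _ fun i => ?_)
  set e := I.orderEmbOfFin rfl
  -- Reversing both orders turns the lower bound on an increasing enumeration into the upper bound
  -- needed for the last columns.
  have hrev : StrictMono (fun i => Fin.rev (e (Fin.rev i))) := fun a b hab =>
    Fin.rev_lt_rev.2 (e.strictMono (Fin.rev_lt_rev.2 hab))
  have := val_le_of_strictMono hrev (Fin.rev i)
  rw [Fin.rev_rev, Fin.val_rev, Fin.val_rev] at this
  have h1 := (e i).2
  have h2 := i.2
  have h3 := card_le I
  rw [Fin.le_def]
  change (e i : ℕ) ≤ n - I.card + i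
  omega

theorem upperMinor_pos {n : ℕ} {M : Matrix (Fin n) (Fin n) ℝ} (hM : IsTotallyPositive M)
    (I : Finset (Fin n)) : 0 < upperMinor M I :=
  hM.2 _ _ _ (not_vanishesIdentically _ _ fun i =>
    val_le_of_strictMono (I.orderEmbOfFin rfl).strictMono i)

/-! ### The four families as cross-ratios of flag minors. -/

open scoped Classical in
/-- The elements of `Fin n` whose label lies in `S`. -/
noncomputable def labelled (n : ℕ) (S : Set ℕ) : Finset (Fin n) :=
  Finset.univ.filter fun i => i.val + 1 ∈ S

theorem isFlagLike_of_finset {n : ℕ} {f : Finset (Fin n) → ℝ} (hpos : ∀ I, 0 < f I)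
    (hrel : ∀ (I : Finset (Fin n)) (a b c : Fin n), a < b → b < c → a ∉ I → b ∉ I → c ∉ I →
      f (insert a (insert c I)) * f (insert b I) =
        f (insert a (insert b I)) * f (insert c I) + f (insert b (insert c I)) * f (insert a I)) :
    IsFlagLike n fun S => f (labelled n S) where
  pos S := hpos _
  congr S T h := by
    congr 1
    ext i
    simp only [labelled, Finset.mem_filter, Finset.mem_univ, true_and]
    exact h _ (by omega) (by omega)
  rel S a b c h1 hab hbc hn ha hb hc := by
    have hins : ∀ (U : Set ℕ) (x : ℕ) (hx : 1 ≤ x) (hxn : x ≤ n),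
        labelled n (insert x U) = insert (⟨x - 1, by omega⟩ : Fin n) (labelled n U) := by
      intro U x hx hxn
      ext i
      simp only [labelled, Finset.mem_filter, Finset.mem_univ, true_and, Finset.mem_insert,
        Set.mem_insert_iff, Fin.ext_iff]
      have : (i : ℕ) + 1 = x ↔ (i : ℕ) = x - 1 := by omega
      rw [this]
    have hmem : ∀ (x : ℕ) (hx : 1 ≤ x) (hxn : x ≤ n), x ∉ S →
        (⟨x - 1, by omega⟩ : Fin n) ∉ labelled n S := by
      intro x hx hxn hxS
      simpa [labelled, Nat.sub_add_cancel hx] using hxS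
    rw [hins _ a h1 (by omega), hins _ c (by omega) hn, hins _ a h1 (by omega),
      hins _ b (by omega) (by omega), hins _ b (by omega) (by omega), hins _ c (by omega) hn,
      hins _ a h1 (by omega)]
    exact hrel _ _ _ _ (Fin.mk_lt_mk.2 (by omega)) (Fin.mk_lt_mk.2 (by omega))
      (hmem a h1 (by omega) ha) (hmem b (by omega) (by omega) hb) (hmem c (by omega) hn hc)


theorem isFlagLike_rightMinor {n : ℕ} {M : Matrix (Fin n) (Fin n) ℝ} (hM : IsTotallyPositive M) :
    IsFlagLike n fun S => rightMinor M (labelled n S) :=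
  isFlagLike_of_finset (rightMinor_pos hM) fun _ _ _ _ hab hbc ha hb hc =>
    rightMinor_three_term M hab hbc ha hb hc

theorem isFlagLike_upperMinor {n : ℕ} {M : Matrix (Fin n) (Fin n) ℝ} (hM : IsTotallyPositive M) :
    IsFlagLike n fun S => upperMinor M (labelled n S) :=
  isFlagLike_of_finset (upperMinor_pos hM) fun _ _ _ _ hab hbc ha hb hc =>
    upperMinor_three_term M hab hbc ha hb hc

theorem labelled_eq_union {n : ℕ} {S : Set ℕ} {a b c d : ℕ}
    (h : ∀ i, 1 ≤ i → i ≤ n → (i ∈ S ↔ (a ≤ i ∧ i ≤ b) ∨ (c ≤ i ∧ i ≤ d))) :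
    labelled n S = seg n a b ∪ seg n c d := by
  ext i
  simp only [labelled, seg, Finset.mem_filter, Finset.mem_univ, true_and, Finset.mem_union]
  exact h _ (by omega) (by omega)

theorem YLow_eq_crossY {n : ℕ} (M : Matrix (Fin n) (Fin n) ℝ) {a b c : ℕ} (hab : a < b)
    (hbc : b < c) :
    YLow M a b c =
      crossY (fun S => rightMinor M (labelled n S)) {i | a < i ∧ i < b ∨ c < i} a b c := by
  unfold YLow crossY
  dsimp only
  congr 3 <;> refine (labelled_eq_union fun i _ _ => ?_).symm <;>
    simp only [Set.mem_insert_iff, Set.mem_ofPred_eq] <;> omega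

theorem YTildeLow_eq_crossY {n : ℕ} (M : Matrix (Fin n) (Fin n) ℝ) {a b c : ℕ} (ha : 1 ≤ a)
    (hab : a < b) (hbc : b < c) :
    YTildeLow M a b c =
      crossY (fun S => rightMinor M (labelled n S)) {i | i < a ∨ b < i ∧ i < c} a b c := by
  unfold YTildeLow crossY
  dsimp only
  congr 3 <;> refine (labelled_eq_union fun i _ _ => ?_).symm <;>
    simp only [Set.mem_insert_iff, Set.mem_ofPred_eq] <;> omega

theorem YUp_eq_crossY {n : ℕ} (M : Matrix (Fin n) (Fin n) ℝ) {a b c : ℕ} (hab : a < b)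
    (hbc : b < c) :
    YUp M a b c =
      (crossY (fun S => upperMinor M (labelled n S)) {i | a < i ∧ i < b ∨ c < i} a b c)⁻¹ := by
  unfold YUp crossY
  rw [inv_div]
  dsimp only
  congr 3 <;> refine (labelled_eq_union fun i _ _ => ?_).symm <;>
    simp only [Set.mem_insert_iff, Set.mem_ofPred_eq] <;> omega

theorem YTildeUp_eq_crossY {n : ℕ} (M : Matrix (Fin n) (Fin n) ℝ) {a b c : ℕ} (ha : 1 ≤ a)
    (hab : a < b) (hbc : b < c) :
    YTildeUp M a b c =
      (crossY (fun S => upperMinor M (labelled n S)) {i | i < a ∨ b < i ∧ i < c} a b c)⁻¹ := by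
  unfold YTildeUp crossY
  rw [inv_div]
  dsimp only
  congr 3 <;> refine (labelled_eq_union fun i _ _ => ?_).symm <;>
    simp only [Set.mem_insert_iff, Set.mem_ofPred_eq] <;> omega

theorem sum_ell_YLow {n : ℕ} {M : Matrix (Fin n) (Fin n) ℝ} (hM : IsTotallyPositive M) :
    ∑ t ∈ tetra n, ell (YLow M t.1 t.2.1 t.2.2) =
      ∑ t ∈ tetra n, ell (YTildeLow M t.1 t.2.1 t.2.2) := by
  convert sum_ell_crossY (isFlagLike_rightMinor hM) using 2 with t ht t ht
  · obtain ⟨h1, h2, h3, h4⟩ := mem_tetra.1 ht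
    rw [YLow_eq_crossY M h2 h3]
  · obtain ⟨h1, h2, h3, h4⟩ := mem_tetra.1 ht
    rw [YTildeLow_eq_crossY M h1 h2 h3]

theorem sum_ell_YUp {n : ℕ} {M : Matrix (Fin n) (Fin n) ℝ} (hM : IsTotallyPositive M) :
    ∑ t ∈ tetra n, ell (YUp M t.1 t.2.1 t.2.2) =
      ∑ t ∈ tetra n, ell (YTildeUp M t.1 t.2.1 t.2.2) := by
  have hF := isFlagLike_upperMinor hM
  have key := sum_ell_crossY hF
  have h1 : ∀ t ∈ tetra n, ell (YUp M t.1 t.2.1 t.2.2) = 2 * ell 1 -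
      ell (crossY (fun S => upperMinor M (labelled n S))
        {i | t.1 < i ∧ i < t.2.1 ∨ t.2.2 < i} t.1 t.2.1 t.2.2) := by
    intro t ht
    obtain ⟨h1, h2, h3, h4⟩ := mem_tetra.1 ht
    rw [YUp_eq_crossY M h2 h3, ← ell_add_ell_inv (crossY_pos hF _ _ _ _)]
    ring
  have h2 : ∀ t ∈ tetra n, ell (YTildeUp M t.1 t.2.1 t.2.2) = 2 * ell 1 -
      ell (crossY (fun S => upperMinor M (labelled n S))
        {i | i < t.1 ∨ t.2.1 < i ∧ i < t.2.2} t.1 t.2.1 t.2.2) := by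
    intro t ht
    obtain ⟨h1, h2, h3, h4⟩ := mem_tetra.1 ht
    rw [YTildeUp_eq_crossY M h1 h2 h3, ← ell_add_ell_inv (crossY_pos hF _ _ _ _)]
    ring
  rw [Finset.sum_congr rfl h1, Finset.sum_congr rfl h2, Finset.sum_sub_distrib,
    Finset.sum_sub_distrib, key]

/-! ### Solid minors and the link between right and upper flag minors. -/

/-- The minor of `M` with `k` consecutive rows from `r` on and `k` consecutive columns from `c` on
(numbered from `0`). -/
noncomputable def solidMinor {n : ℕ} (M : Matrix (Fin n) (Fin n) ℝ) (r c k : ℕ) : ℝ :=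
  (Matrix.of fun i j : Fin k =>
    if h : r + i < n ∧ c + j < n then M ⟨r + i, h.1⟩ ⟨c + j, h.2⟩ else 0).det

theorem orderEmbOfFin_eq_of_mem_iff {n k : ℕ} {I : Finset (Fin n)} {f : Fin k → Fin n}
    (hf : StrictMono f) (hI : ∀ x, x ∈ I ↔ ∃ i, f i = x) :
    ∃ h : I.card = k, ⇑(I.orderEmbOfFin h) = f := by
  have hIf : I = Finset.univ.image f := by ext x; simp [hI]
  have hc : I.card = k := by
    rw [hIf, Finset.card_image_of_injective _ hf.injective, Finset.card_fin]
  exact ⟨hc, (Finset.orderEmbOfFin_unique hc (fun i => (hI _).2 ⟨i, rfl⟩) hf).symm⟩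

/-- Increasing enumeration of the union of two intervals of lengths `k`, `l` starting at `p`, `q`. -/
def twoIntervals {n : ℕ} (p q k l : ℕ) (hq : q + l ≤ n) (hpq : p + k ≤ q) :
    Fin (k + l) → Fin n :=
  fun i => ⟨if i.val < k then p + i else q + (i - k), by split_ifs <;> omega⟩

theorem twoIntervals_strictMono {n p q k l : ℕ} (hq : q + l ≤ n) (hpq : p + k ≤ q) :
    StrictMono (twoIntervals p q k l hq hpq) := by
  intro i j hij
  rw [Fin.lt_def] at hij ⊢
  simp only [twoIntervals]
  split_ifs <;> omega

theorem det_eq_mul_of_block {k l : ℕ} (A : Matrix (Fin (k + l)) (Fin (k + l)) ℝ)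
    (h : ∀ (i : Fin l) (j : Fin k), A (Fin.natAdd k i) (Fin.castAdd l j) = 0) :
    A.det = (Matrix.of fun i j : Fin k => A (Fin.castAdd l i) (Fin.castAdd l j)).det *
      (Matrix.of fun i j : Fin l => A (Fin.natAdd k i) (Fin.natAdd k j)).det := by
  rw [← Matrix.det_submatrix_equiv_self finSumFinEquiv A, ← Matrix.det_fromBlocks_zero₂₁
    _ (Matrix.of fun (i : Fin k) (j : Fin l) => A (Fin.castAdd l i) (Fin.natAdd k j))]
  congr 1
  ext i j
  rcases i with i | i <;> rcases j with j | j <;> simp [h]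

theorem det_eq_one_of_unitriangular {n k : ℕ} {M : Matrix (Fin n) (Fin n) ℝ}
    (hM : IsUnipotentUpper M) {f : Fin k → Fin n} (hf : StrictMono f) :
    (M.submatrix f f).det = 1 := by
  have h : (M.submatrix f f).IsUpperTriangular := fun i j hij => hM.1.1 _ _ (hf hij)
  rw [Matrix.det_of_isUpperTriangular h]
  exact Finset.prod_eq_one fun i _ => hM.2 _

/-- Rows beyond `c` vanish on columns up to `c`, so the minor is block triangular; its lower right
block is unitriangular and contributes `1`. -/
theorem rightMinor_union {n : ℕ} {M : Matrix (Fin n) (Fin n) ℝ} (hM : IsUnipotentUpper M)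
    {a b c : ℕ} (ha : 1 ≤ a) (hab : a ≤ b + 1) (hbc : b ≤ c) (hc : c ≤ n) :
    rightMinor M (seg n a b ∪ seg n (c + 1) n) =
      solidMinor M (a - 1) (c - (b + 1 - a)) (b + 1 - a) := by
  have hq : c + (n - c) ≤ n := by omega
  have hpq : a - 1 + (b + 1 - a) ≤ c := by omega
  obtain ⟨h, he⟩ := orderEmbOfFin_eq_of_mem_iff (I := seg n a b ∪ seg n (c + 1) n)
    (twoIntervals_strictMono hq hpq) (by
      intro x
      simp only [seg, Finset.mem_union, Finset.mem_filter, Finset.mem_univ, true_and,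
        twoIntervals, Fin.ext_iff]
      constructor
      · rintro (hx | hx)
        · refine ⟨⟨x - (a - 1), by omega⟩, ?_⟩
          dsimp only
          rw [if_pos (by omega)]; omega
        · refine ⟨⟨b + 1 - a + (x - c), by omega⟩, ?_⟩
          dsimp only
          rw [if_neg (by omega)]; omega
      · rintro ⟨i, hi⟩
        have := i.2
        split_ifs at hi <;> omega)
  rw [rightMinor_eq M h (by omega), he, det_eq_mul_of_block]
  · have h2 : (Matrix.of fun i j : Fin (n - c) =>
        M.submatrix (twoIntervals (a - 1) c (b + 1 - a) (n - c) hq hpq)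
          (lastEmb (show b + 1 - a + (n - c) ≤ n by omega))
          (Fin.natAdd _ i) (Fin.natAdd _ j)).det = 1 := by
      rw [← det_eq_one_of_unitriangular hM (k := n - c)
        (f := fun i => ⟨c + i, by omega⟩) (fun i j hij => Nat.add_lt_add_left hij c)]
      congr 1
      ext i j
      simp only [Matrix.of_apply, Matrix.submatrix_apply]
      congr 1 <;> ext
      · simp [twoIntervals]
      · change n - (b + 1 - a + (n - c)) + (b + 1 - a + j : ℕ) = c + j
        omega
    rw [h2, mul_one, solidMinor]
    congr 1
    ext i j
    rw [Matrix.of_apply, Matrix.of_apply, dif_pos (by omega), Matrix.submatrix_apply]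
    congr 1 <;> ext
    · simp [twoIntervals]
    · change n - (b + 1 - a + (n - c)) + (j : ℕ) = c - (b + 1 - a) + j
      omega
  · intro i j
    rw [Matrix.submatrix_apply]
    refine hM.1.1 _ _ ?_
    rw [Fin.lt_def]
    change n - (b + 1 - a + (n - c)) + (j : ℕ) < _
    simp only [twoIntervals, Fin.val_natAdd]
    rw [if_neg (by omega)]
    omega

/-- Again block triangular, this time with the unitriangular block at the upper left, on rows and
columns up to `a`. -/
theorem upperMinor_union {n : ℕ} {M : Matrix (Fin n) (Fin n) ℝ} (hM : IsUnipotentUpper M)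
    {a b c : ℕ} (hab : a < b) (hbc : b ≤ c + 1) (hc : c ≤ n) :
    upperMinor M (seg n 1 a ∪ seg n b c) = solidMinor M a (b - 1) (c + 1 - b) := by
  have hq : b - 1 + (c + 1 - b) ≤ n := by omega
  have hpq : 0 + a ≤ b - 1 := by omega
  obtain ⟨h, he⟩ := orderEmbOfFin_eq_of_mem_iff (I := seg n 1 a ∪ seg n b c)
    (twoIntervals_strictMono hq hpq) (by
      intro x
      simp only [seg, Finset.mem_union, Finset.mem_filter, Finset.mem_univ, true_and,
        twoIntervals, Fin.ext_iff]
      constructor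
      · rintro (hx | hx)
        · refine ⟨⟨x, by omega⟩, ?_⟩
          dsimp only
          rw [if_pos (by omega)]; omega
        · refine ⟨⟨a + (x - (b - 1)), by omega⟩, ?_⟩
          dsimp only
          rw [if_neg (by omega)]; omega
      · rintro ⟨i, hi⟩
        have := i.2
        split_ifs at hi <;> omega)
  rw [upperMinor_eq M h (by omega), he, ← Matrix.det_transpose, Matrix.transpose_submatrix,
    Matrix.transpose_transpose, det_eq_mul_of_block]
  · have h2 : (Matrix.of fun i j : Fin a =>
        M.submatrix (firstEmb (show a + (c + 1 - b) ≤ n by omega))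
          (twoIntervals 0 (b - 1) a (c + 1 - b) hq hpq)
          (Fin.castAdd _ i) (Fin.castAdd _ j)).det = 1 := by
      rw [← det_eq_one_of_unitriangular hM (k := a)
        (f := fun i => ⟨i, by omega⟩) (fun i j hij => hij)]
      congr 1
      ext i j
      simp only [Matrix.of_apply, Matrix.submatrix_apply]
      congr 1
      ext
      simp [twoIntervals]
    rw [h2, one_mul, solidMinor]
    congr 1
    ext i j
    rw [Matrix.of_apply, Matrix.of_apply, dif_pos (by omega), Matrix.submatrix_apply]
    congr 1
    ext
    simp [twoIntervals]
  · intro i j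
    rw [Matrix.submatrix_apply]
    refine hM.1.1 _ _ ?_
    rw [Fin.lt_def]
    change _ < a + (i : ℕ)
    simp only [twoIntervals, Fin.val_castAdd]
    rw [if_pos j.2]
    omega

theorem YLow_eq_YTildeUp {n : ℕ} {M : Matrix (Fin n) (Fin n) ℝ} (hM : IsUnipotentUpper M)
    {a b c : ℕ} (ha : 1 ≤ a) (hab : a < b) (hbc : b < c) (hc : c ≤ n) :
    YLow M a b c = YTildeUp M a (a + c - b) c := by
  obtain ⟨k, rfl⟩ : ∃ k, b = a + (k + 1) := ⟨b - a - 1, by omega⟩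
  obtain ⟨m, rfl⟩ : ∃ m, c = a + (k + 1) + (m + 1) := ⟨c - (a + (k + 1)) - 1, by omega⟩
  have e : a + (a + (k + 1) + (m + 1)) - (a + (k + 1)) = a + (m + 1) := by omega
  have s1 := rightMinor_union hM (a := a) (b := a + k) (c := a + (k + 1) + (m + 1))
    ha (by omega) (by omega) hc
  have s2 := rightMinor_union hM (a := a + 1) (b := a + (k + 1)) (c := a + (k + 1) + m)
    (by omega) (by omega) (by omega) (by omega)
  have s3 := rightMinor_union hM (a := a) (b := a + (k + 1)) (c := a + (k + 1) + (m + 1))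
    ha (by omega) (by omega) hc
  have s4 := rightMinor_union hM (a := a + 1) (b := a + k) (c := a + (k + 1) + m)
    (by omega) (by omega) (by omega) (by omega)
  have t1 := upperMinor_union hM (a := a) (b := a + (m + 1)) (c := a + (k + 1) + m)
    (by omega) (by omega) (by omega)
  have t2 := upperMinor_union hM (a := a - 1) (b := a + (m + 1) + 1) (c := a + (k + 1) + (m + 1))
    (by omega) (by omega) hc
  have t3 := upperMinor_union hM (a := a) (b := a + (m + 1) + 1) (c := a + (k + 1) + m)
    (by omega) (by omega) (by omega)
  have t4 := upperMinor_union hM (a := a - 1) (b := a + (m + 1)) (c := a + (k + 1) + (m + 1))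
    (by omega) (by omega) hc
  have f1 : a + (k + 1) - 1 = a + k := by omega
  have f2 : a + (k + 1) + (m + 1) - 1 = a + (k + 1) + m := by omega
  have f3 : a + (k + 1) + (m + 1) = a + (k + 1) + m + 1 := by omega
  have g1 : solidMinor M (a - 1) (a + (k + 1) + (m + 1) - (a + k + 1 - a)) (a + k + 1 - a) =
      solidMinor M (a - 1) (a + (m + 1) + 1 - 1)
        (a + (k + 1) + (m + 1) + 1 - (a + (m + 1) + 1)) := by congr 1 <;> omega
  have g2 : solidMinor M (a + 1 - 1) (a + (k + 1) + m - (a + (k + 1) + 1 - (a + 1)))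
        (a + (k + 1) + 1 - (a + 1)) =
      solidMinor M a (a + (m + 1) - 1) (a + (k + 1) + m + 1 - (a + (m + 1))) := by
    congr 1 <;> omega
  have g3 : solidMinor M (a - 1) (a + (k + 1) + (m + 1) - (a + (k + 1) + 1 - a))
        (a + (k + 1) + 1 - a) =
      solidMinor M (a - 1) (a + (m + 1) - 1)
        (a + (k + 1) + (m + 1) + 1 - (a + (m + 1))) := by congr 1 <;> omega
  have g4 : solidMinor M (a + 1 - 1) (a + (k + 1) + m - (a + k + 1 - (a + 1)))
        (a + k + 1 - (a + 1)) =
      solidMinor M a (a + (m + 1) + 1 - 1) (a + (k + 1) + m + 1 - (a + (m + 1) + 1)) := by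
    congr 1 <;> omega
  rw [← f3] at s2 s4
  unfold YLow YTildeUp
  -- The solid minors agree crosswise: the first factor of each product on one side is the second
  -- factor on the other.
  rw [e, f1, f2, s1, s2, s3, s4, t1, t2, t3, t4, g1, g2, g3, g4, mul_comm (solidMinor M (a - 1) _ _),
    mul_comm (solidMinor M (a - 1) _ _)]

theorem sum_ell_YLow_eq_YTildeUp {n : ℕ} {M : Matrix (Fin n) (Fin n) ℝ}
    (hM : IsUnipotentUpper M) :
    ∑ t ∈ tetra n, ell (YLow M t.1 t.2.1 t.2.2) =
      ∑ t ∈ tetra n, ell (YTildeUp M t.1 t.2.1 t.2.2) := by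
  refine Finset.sum_nbij' (fun t => (t.1, t.1 + t.2.2 - t.2.1, t.2.2))
    (fun t => (t.1, t.1 + t.2.2 - t.2.1, t.2.2)) ?_ ?_ ?_ ?_ ?_ <;> intro t ht <;>
    obtain ⟨h1, h2, h3, h4⟩ := mem_tetra.1 ht
  · exact mem_tetra.2 (by dsimp only; omega)
  · exact mem_tetra.2 (by dsimp only; omega)
  · ext <;> dsimp only
    omega
  · ext <;> dsimp only
    omega
  · rw [YLow_eq_YTildeUp hM h1 h2 h3 h4]

end TPDilog

theorem proposition3p7 (n : ℕ) (hn : 2 ≤ n) (M : Matrix (Fin n) (Fin n) ℝ)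
    (hM : M ∈ TPDilog.NPlus n) :
    (∀ a b c : ℕ, 1 ≤ a → a < b → b < c → c ≤ n →
      0 < TPDilog.YLow M a b c ∧ 0 < TPDilog.YTildeUp M a b c ∧
      0 < TPDilog.YTildeLow M a b c ∧ 0 < TPDilog.YUp M a b c) ∧
    ∑ t ∈ TPDilog.tetra n, TPDilog.ell (TPDilog.YLow M t.1 t.2.1 t.2.2) =
      ∑ t ∈ TPDilog.tetra n, TPDilog.ell (TPDilog.YTildeUp M t.1 t.2.1 t.2.2) ∧
    ∑ t ∈ TPDilog.tetra n, TPDilog.ell (TPDilog.YTildeUp M t.1 t.2.1 t.2.2) =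
      ∑ t ∈ TPDilog.tetra n, TPDilog.ell (TPDilog.YTildeLow M t.1 t.2.1 t.2.2) ∧
    ∑ t ∈ TPDilog.tetra n, TPDilog.ell (TPDilog.YTildeLow M t.1 t.2.1 t.2.2) =
      ∑ t ∈ TPDilog.tetra n, TPDilog.ell (TPDilog.YUp M t.1 t.2.1 t.2.2) := by
  obtain ⟨hU, hT⟩ := hM
  have hLow := TPDilog.sum_ell_YLow hT
  have hUp := TPDilog.sum_ell_YUp hT
  have hLU := TPDilog.sum_ell_YLow_eq_YTildeUp hU
  have hr := TPDilog.rightMinor_pos hT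
  have hu := TPDilog.upperMinor_pos hT
  refine ⟨fun a b c _ _ _ _ => ⟨?_, ?_, ?_, ?_⟩, hLU, hLU.symm.trans hLow,
    (hLow.symm.trans hLU).trans hUp.symm⟩
  · exact div_pos (mul_pos (hr _) (hr _)) (mul_pos (hr _) (hr _))
  · exact div_pos (mul_pos (hu _) (hu _)) (mul_pos (hu _) (hu _))
  · exact div_pos (mul_pos (hr _) (hr _)) (mul_pos (hr _) (hr _))
  · exact div_pos (mul_pos (hu _) (hu _)) (mul_pos (hu _) (hu _))
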